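/- **The game.** Fix a discount rate $r>0$. There are two players, Aqua and Bard, each with action set $\{a,b\}$. The instantaneous payoffs are $g^{\rm Bard}(x,y)=\mathbf 1_{\{x=y\}}$ and $g^{\rm Aqua}(x,y)=\mathbf 1_{\{x\ne y\}}$, where $x$ is Aqua's action and $y$ is Bard's. A *control* is a measurable function $u:\mathbb R_+\to\{a,b\}$. The set $\mathcal U$ of controls carries the Borel $\sigma$-algebra of the distance $d(u,w)=\int_0^\infty re^{-rt}\mathbf 1_{\{u_t\neq w_t\}}\,dt$. The discounted payoff of player $i$ under a pair of controls is $\gamma^i(u^{\rm Aqua},u^{\rm Bard})=\int_0^\infty re^{-rt}g^i(u^{\rm Aqua}_t,u^{\rm Bard}_t)\,dt$. **Strategies.** A (pure) *strategy* (with delay) of a player is a measurable map $\sigma:\mathcal U\to\mathcal U$, from the opponent's controls to her own, for which there is a sequence $0=t_0<t_1<\cdots$ with $t_n\to\infty$ such that for all $n\ge 0$ and all $u,w\in\mathcal U$: if $u=w$ a.e. on $[0,t_n]$, then $\sigma(u)=\sigma(w)$ a.e. on $[0,t_{n+1}]$. A *mixed strategy* is a probability space $(\Omega,\mathcal F,\mathbf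 P)$ together with a jointly measurable map $\mu:\Omega\times\mathcal U\to\mathcal U$ such that $\mu(\omega,\cdot)$ is a strategy for $\mathbf P$-a.e. $\omega$; the sequence $(t_n)$ may depend on $\omega$. A pure strategy is regarded as a mixed strategy over a one-point space. **Expected payoffs.** A pair of pure strategies $(\sigma^{\rm Aqua},\sigma^{\rm Bard})$ induces a play $(u^{\rm Aqua},u^{\rm Bard})$, unique up to a.e. equality, with $\sigma^{\rm Aqua}(u^{\rm Bard})=u^{\rm Aqua}$ and $\sigma^{\rm Bard}(u^{\rm Aqua})=u^{\rm Bard}$ a.e. A pair of mixed strategies $(\mu^{\rm Aqua},\mu^{\rm Bard})$ induces the law of this play when the two sample points are drawn independently, and $\gamma^i(\mu^{\rm Aqua},\mu^{\rm Bard})$ is the expectation of $\gamma^i$ under that law. **Proposition.** 1. For every mixed strategy $\mu^{\rm Aqua}$ of Aqua and every $\varepsilon>0$ there is a pure strategy $\sigma^{\rm Bard}$ of Bard such that $\gamma^{\rm Bard}(\mu^{\rm Aqua},\sigma^{\rm Bard})>1-\varepsilon$. 2. For every mixed strategy $\mu^{\rm Bard}$ of Bard and every $\varepsilon>0$ there is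 a pure strategy $\sigma^{\rm Aqua}$ of Aqua such that $\gamma^{\rm Aqua}(\sigma^{\rm Aqua},\mu^{\rm Bard})>1-\varepsilon$. 3. Consequently, for each player, the minmax value of the continuous-time game (the infimum over the opponent's mixed strategies of the supremum over the player's own mixed strategies of the player's expected payoff) equals her minmax value in pure strategies of the one-shot game, $\min_{\text{opponent's action}}\ \max_{\text{own action}} g^i$, and both are equal to $1$: $$\inf_{\mu^{\rm Aqua}}\sup_{\mu^{\rm Bard}}\gamma^{\rm Bard}(\mu^{\rm Aqua},\mu^{\rm Bard})=\min_{x}\max_{y}g^{\rm Bard}(x,y)=1,\qquad \inf_{\mu^{\rm Bard}}\sup_{\mu^{\rm Aqua}}\gamma^{\rm Aqua}(\mu^{\rm Aqua},\mu^{\rm Bard})=\min_{y}\max_{x}g^{\rm Aqua}(x,y)=1.$$ -/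

import Mathlib

open MeasureTheory Filter Topology
open scoped NNReal ENNReal

universe u v

noncomputable section

namespace MatchingPennies

/-- The two players. -/
inductive Player where
  | aqua
  | bard

/-- The two actions `a = true` and `b = false`, the same for both players. -/
abbrev Action : Type := Bool

/-- Instantaneous payoff `g^i (x^Aqua, x^Bard)`: Aqua wants to mismatch, Bard wants to match. -/
def stagePayoff : Player → Action → Action → ℝ
  | .aqua, x, y => if x ≠ y then 1 else 0
  | .bard, x, y => if x = y then 1 else 0

/-- Pure minmax value of the one-shot game: the opponent commits to an action, the player
best-responds. -/
def oneShotPureMinmax : Player → ℝ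
  | .aqua => ⨅ y : Action, ⨆ x : Action, stagePayoff .aqua x y
  | .bard => ⨅ x : Action, ⨆ y : Action, stagePayoff .bard x y

/-- Lebesgue measure on `ℝ₊`. -/
instance : MeasureSpace ℝ≥0 where
  volume := Measure.comap ((↑) : ℝ≥0 → ℝ) volume

/-- The discount density `r e^{-rt}` on `ℝ₊`. -/
def discount (r : ℝ) (t : ℝ≥0) : ℝ := r * Real.exp (-r * t)

/-- Controls: measurable functions `ℝ₊ → {a, b}`. They are not identified when a.e. equal. The
discount rate `r` only serves to select the distance below. -/
structure Control (r : ℝ) where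
  /-- the action at each time -/
  toFun : ℝ≥0 → Action
  measurable_toFun : Measurable toFun

variable {r : ℝ}

instance : CoeFun (Control r) (fun _ => ℝ≥0 → Action) := ⟨Control.toFun⟩

instance : Inhabited (Control r) := ⟨⟨fun _ => true, measurable_const⟩⟩

/-- The distance `d(u, w) = ∫₀^∞ r e^{-rt} 1_{u_t ≠ w_t} dt`, written with values in `[0, ∞]`;
see `Control.edist_eq` for the real-valued form. -/
instance : PseudoEMetricSpace (Control r) where
  edist f g := ∫⁻ t, ENNReal.ofReal (discount r t) * (if f t ≠ g t then 1 else 0)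
  edist_self f := by simp
  edist_comm f g := by simp only [ne_comm]
  edist_triangle f g h := by
    have hm : Measurable fun t : ℝ≥0 =>
        ENNReal.ofReal (discount r t) * (if f t ≠ g t then (1 : ℝ≥0∞) else 0) := by
      refine Measurable.mul (by unfold discount; fun_prop) (Measurable.ite ?_ (by fun_prop)
        (by fun_prop))
      exact (measurableSet_eq_fun f.2 g.2).compl
    rw [← lintegral_add_left hm]
    refine lintegral_mono fun t => ?_
    dsimp only
    rw [← mul_add]
    gcongr
    by_cases h1 : f t = g t
    · simp [h1]
    · rw [if_pos h1]
      exact le_trans (by split_ifs <;> simp) le_self_add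

/-- The Borel `σ`-algebra of the distance `d`. -/
instance : MeasurableSpace (Control r) := borel _

instance : BorelSpace (Control r) := ⟨rfl⟩

/-- The two controls coincide a.e. on `[0, T]`. -/
def AgreeUpTo (T : ℝ≥0) (f g : Control r) : Prop := ∀ᵐ s : ℝ≥0, s ≤ T → f s = g s

/-- Pure strategies (with delay): measurable maps from the opponent's controls to one's own, for
which there is a time grid `0 = t₀ < t₁ < ⋯ → ∞` such that the answer on `[0, tₙ₊₁]` depends only
on the opponent's control on `[0, tₙ]`. -/
def IsStrategy (σ : Control r → Control r) : Prop :=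
  Measurable σ ∧ ∃ t : ℕ → ℝ≥0, t 0 = 0 ∧ StrictMono t ∧ Tendsto t atTop atTop ∧
    ∀ n, ∀ f g : Control r, AgreeUpTo (t n) f g → AgreeUpTo (t (n + 1)) (σ f) (σ g)

/-- The set of strategies of a player. Both players have the same actions, hence the same set. -/
def Strategy (r : ℝ) : Type := {σ : Control r → Control r // IsStrategy σ}

/-- Mixed strategies: a probability space and a jointly measurable map such that almost every
section is a strategy. The time grid may depend on the sample point, in any way. -/
structure MixedStrategy (r : ℝ) where
  /-- the sample space -/
  Ω : Type u
  [measurableSpace : MeasurableSpace Ω]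
  /-- the probability on it -/
  P : Measure Ω
  [isProbabilityMeasure : IsProbabilityMeasure P]
  /-- the random strategy -/
  act : Ω × Control r → Control r
  measurable_act : Measurable act
  ae_isStrategy : ∀ᵐ ω ∂P, IsStrategy fun f => act (ω, f)

attribute [instance] MixedStrategy.measurableSpace MixedStrategy.isProbabilityMeasure

/-- A pure strategy, seen as a mixed strategy over a one-point probability space. -/
def Strategy.toMixed (σ : Strategy r) : MixedStrategy.{u} r where
  Ω := PUnit
  P := Measure.dirac PUnit.unit
  act p := σ.1 p.2
  measurable_act := σ.2.1.comp measurable_snd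
  ae_isStrategy := Eventually.of_forall fun _ => σ.2

/-- `p = (u^Aqua, u^Bard)` is a play induced by the two maps: `σ^i(u^{-i}) = u^i` a.e. on `ℝ₊` for
each player. -/
def IsPlay (σA σB : Control r → Control r) (p : Control r × Control r) : Prop :=
  (∀ᵐ s : ℝ≥0, σA p.2 s = p.1 s) ∧ (∀ᵐ s : ℝ≥0, σB p.1 s = p.2 s)

open Classical in
/-- The play induced by a pair of strategies. It exists and is unique up to a.e. equality by
`exists_isPlay` and `IsPlay.ae_unique`; for maps without a play (which are not strategies) the
value is arbitrary. -/
def play (σA σB : Control r → Control r) : Control r × Control r :=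
  if h : ∃ p, IsPlay σA σB p then h.choose else default

/-- The distribution over plays induced by a pair of mixed strategies: the law of the play when the
two sample points are drawn independently. It is a probability by
`isProbabilityMeasure_playLaw`. -/
def playLaw (μA : MixedStrategy.{u} r) (μB : MixedStrategy.{v} r) :
    Measure (Control r × Control r) :=
  (μA.P.prod μB.P).map fun ω => play (fun f => μA.act (ω.1, f)) (fun f => μB.act (ω.2, f))

/-- The discounted payoff `γ^i(u) = ∫₀^∞ r e^{-rt} g^i(u(t)) dt` of a pair of controls. -/
def payoff (i : Player) (p : Control r × Control r) : ℝ :=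
  ∫ t : ℝ≥0, discount r t * stagePayoff i (p.1 t) (p.2 t)

/-- The expected discounted payoff of a pair of mixed strategies. -/
def expectedPayoff (i : Player) (μA : MixedStrategy.{u} r) (μB : MixedStrategy.{v} r) : ℝ :=
  ∫ p, payoff i p ∂(playLaw μA μB)

/-- The minmax value of a player in the continuous-time game with discount rate `r`, over mixed
strategies: the infimum over the opponent's mixed strategies of the supremum over the player's own
mixed strategies of the player's expected payoff. -/
def minmaxValue (r : ℝ) : Player → ℝ
  | .aqua => ⨅ μB : MixedStrategy.{u} r, ⨆ μA : MixedStrategy.{v} r, expectedPayoff .aqua μA μB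
  | .bard => ⨅ μA : MixedStrategy.{u} r, ⨆ μB : MixedStrategy.{v} r, expectedPayoff .bard μA μB

/-! Facts showing that the definitions above do not take junk values. -/

theorem integrable_discount (hr : 0 < r) : Integrable (discount r) := by
  have h1 : IntegrableOn (fun t : ℝ => r * Real.exp (-r * t)) (Set.Ici 0) := by
    rw [integrableOn_Ici_iff_integrableOn_Ioi]
    exact (integrableOn_exp_mul_Ioi (by linarith) 0).const_mul r
  rw [IntegrableOn, ← map_comap_subtype_coe measurableSet_Ici,
    (MeasurableEmbedding.subtype_coe measurableSet_Ici).integrable_map_iff] at h1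
  exact h1

theorem discount_nonneg (hr : 0 < r) (t : ℝ≥0) : 0 ≤ discount r t := by
  unfold discount
  positivity

theorem Control.edist_eq (hr : 0 < r) (f g : Control r) :
    edist f g = ENNReal.ofReal (∫ t : ℝ≥0, discount r t * (if f t ≠ g t then 1 else 0)) := by
  have hm : Measurable fun t : ℝ≥0 => if f t ≠ g t then (1 : ℝ) else 0 :=
    Measurable.ite (measurableSet_eq_fun f.2 g.2).compl measurable_const measurable_const
  rw [ofReal_integral_eq_lintegral_ofReal]
  · refine lintegral_congr fun t => ?_
    split_ifs <;> simp
  · refine (integrable_discount hr).mul_bdd (c := 1) hm.aestronglyMeasurable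
      (Eventually.of_forall fun t => ?_)
    split_ifs <;> simp
  · refine Eventually.of_forall fun t => mul_nonneg (discount_nonneg hr t) ?_
    split_ifs <;> simp

theorem AgreeUpTo.mono {S T : ℝ≥0} {f g : Control r} (h : AgreeUpTo T f g) (hST : S ≤ T) :
    AgreeUpTo S f g := by
  filter_upwards [h] with s hs hsS using hs (hsS.trans hST)

theorem AgreeUpTo.symm {T : ℝ≥0} {f g : Control r} (h : AgreeUpTo T f g) : AgreeUpTo T g f := by
  filter_upwards [h] with s hs hsS using (hs hsS).symm

theorem AgreeUpTo.trans {T : ℝ≥0} {f g k : Control r} (h : AgreeUpTo T f g)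
    (h' : AgreeUpTo T g k) : AgreeUpTo T f k := by
  filter_upwards [h, h'] with s hs hs' hsS using (hs hsS).trans (hs' hsS)

theorem agreeUpTo_zero (f g : Control r) : AgreeUpTo 0 f g := by
  have h0 : (volume : Measure ℝ≥0) {0} = 0 := by
    rw [show (volume : Measure ℝ≥0) = Measure.comap ((↑) : ℝ≥0 → ℝ) volume from rfl]
    have := comap_subtype_coe_apply (measurableSet_Ici (a := (0:ℝ))) volume {(0 : ℝ≥0)}
    refine this.trans ?_
    exact (congrArg volume (Set.image_singleton (f := ((↑) : ℝ≥0 → ℝ)) (a := 0))).trans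
      Real.volume_singleton
  have : ∀ᵐ s : ℝ≥0, s ∉ ({0} : Set ℝ≥0) := measure_eq_zero_iff_ae_notMem.1 h0
  filter_upwards [this] with s hs hs0
  exact absurd (le_antisymm hs0 zero_le) (by simpa using hs)

theorem ae_eq_of_agreeUpTo {t : ℕ → ℝ≥0} (ht : Tendsto t atTop atTop) {f g : Control r}
    (h : ∀ n, AgreeUpTo (t n) f g) : ∀ᵐ s : ℝ≥0, f s = g s := by
  filter_upwards [ae_all_iff.2 h] with s hs
  obtain ⟨n, hn⟩ := (ht.eventually_ge_atTop s).exists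
  exact hs n hn

/-- The answer to the answer is again a strategy, with the grid of the outer strategy. -/
theorem IsStrategy.comp {σ τ : Control r → Control r} (hσ : IsStrategy σ) (hτ : IsStrategy τ) :
    IsStrategy (σ ∘ τ) := by
  obtain ⟨hσm, t, ht0, htm, htt, ht⟩ := hσ
  obtain ⟨hτm, s, hs0, hsm, hst, hs⟩ := hτ
  refine ⟨hσm.comp hτm, t, ht0, htm, htt, fun n f g hfg => ht n _ _ ?_⟩
  have key : ∀ k, s k ≤ t n → AgreeUpTo (s (k + 1)) (τ f) (τ g) := fun k hk =>
    hs k f g (hfg.mono hk)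
  obtain ⟨N, hN⟩ := (hst.eventually_ge_atTop (t n)).exists
  by_contra hcon
  have : ∀ k, s k ≤ t n := by
    intro k
    induction k with
    | zero => simp [hs0]
    | succ k ih =>
      by_contra hk
      exact hcon ((key k ih).mono (not_le.1 hk).le)
  exact hcon ((key N (this N)).mono (hN.trans (hsm (Nat.lt_succ_self N)).le))

/-- The iterates of a strategy stabilize on each bounded time interval, at a fixed point. -/
theorem IsStrategy.exists_fixed {τ : Control r → Control r} (hτ : IsStrategy τ) (d : Control r) :
    ∃ f : Control r, (∀ᵐ s : ℝ≥0, τ f s = f s) ∧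
      ∀ T : ℝ≥0, ∃ N, ∀ n, N ≤ n → AgreeUpTo T (τ^[n] d) f := by
  obtain ⟨-, t, ht0, htm, htt, ht⟩ := hτ
  have hit : ∀ n m, n ≤ m → AgreeUpTo (t n) (τ^[n] d) (τ^[m] d) := by
    intro n
    induction n with
    | zero => intro m _; rw [ht0]; exact agreeUpTo_zero _ _
    | succ n ih =>
      intro m hm
      obtain ⟨m, rfl⟩ : ∃ k, m = k + 1 := ⟨m - 1, by omega⟩
      rw [Function.iterate_succ_apply', Function.iterate_succ_apply']
      exact ht n _ _ (ih m (by omega))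
  have hex : ∀ s : ℝ≥0, ∃ n, s ≤ t n := fun s => (htt.eventually_ge_atTop s).exists
  let f : Control r := ⟨fun s => (τ^[Nat.find (hex s)] d) s,
    Measurable.find (f := fun n s => (τ^[n] d) s) (p := fun n s => s ≤ t n)
      (fun n => (τ^[n] d).2) (fun n => measurableSet_Iic) hex⟩
  have hf : ∀ n, AgreeUpTo (t n) (τ^[n] d) f := by
    intro n
    have : ∀ᵐ s : ℝ≥0, ∀ k, k ≤ n → s ≤ t k → (τ^[k] d) s = (τ^[n] d) s :=
      ae_all_iff.2 fun k => by
        by_cases hk : k ≤ n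
        · filter_upwards [hit k n hk] with s hs _ using hs
        · exact Eventually.of_forall fun s h => absurd h hk
    filter_upwards [this] with s hs hsn
    exact (hs (Nat.find (hex s)) (Nat.find_min' (hex s) hsn) (Nat.find_spec (hex s))).symm
  refine ⟨f, ae_eq_of_agreeUpTo htt fun n => ?_, fun T => ?_⟩
  · have h1 := ht n _ _ (hf n)
    rw [← Function.iterate_succ_apply' τ n d] at h1
    exact (h1.symm.trans (hf (n + 1))).mono (htm (Nat.lt_succ_self n)).le
  · obtain ⟨N, hN⟩ := hex T
    exact ⟨N, fun n hn => (hf n).mono (hN.trans (htm.monotone hn))⟩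

/-- Two fixed points of a strategy are a.e. equal. -/
theorem IsStrategy.fixed_unique {τ : Control r → Control r} (hτ : IsStrategy τ) {f g : Control r}
    (hf : ∀ᵐ s : ℝ≥0, τ f s = f s) (hg : ∀ᵐ s : ℝ≥0, τ g s = g s) :
    ∀ᵐ s : ℝ≥0, f s = g s := by
  obtain ⟨-, t, ht0, htm, htt, ht⟩ := hτ
  refine ae_eq_of_agreeUpTo htt fun n => ?_
  induction n with
  | zero => rw [ht0]; exact agreeUpTo_zero _ _
  | succ n ih =>
    filter_upwards [ht n _ _ ih, hf, hg] with s h1 h2 h3 hs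
    rw [← h2, ← h3, h1 hs]

theorem IsStrategy.congr {σ : Control r → Control r} (hσ : IsStrategy σ) {f g : Control r}
    (h : ∀ᵐ s : ℝ≥0, f s = g s) : ∀ᵐ s : ℝ≥0, σ f s = σ g s := by
  obtain ⟨-, t, ht0, htm, htt, ht⟩ := hσ
  refine ae_eq_of_agreeUpTo htt fun n => (ht n f g ?_).mono (htm (Nat.lt_succ_self n)).le
  filter_upwards [h] with s hs _ using hs

/-- A pair of strategies induces a play. -/
theorem exists_isPlay {σA σB : Control r → Control r} (hA : IsStrategy σA) (hB : IsStrategy σB) :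
    ∃ p, IsPlay σA σB p := by
  obtain ⟨f, hf, -⟩ := (hB.comp hA).exists_fixed default
  exact ⟨(σA f, f), Eventually.of_forall fun _ => rfl, hf⟩

theorem isPlay_play {σA σB : Control r → Control r} (hA : IsStrategy σA) (hB : IsStrategy σB) :
    IsPlay σA σB (play σA σB) := by
  have h := exists_isPlay hA hB
  rw [play, dif_pos h]
  exact h.choose_spec

theorem IsPlay.fixed {σA σB : Control r → Control r} (hB : IsStrategy σB)
    {p : Control r × Control r} (hp : IsPlay σA σB p) :
    ∀ᵐ s : ℝ≥0, (σB ∘ σA) p.2 s = p.2 s := by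
  filter_upwards [hB.congr hp.1, hp.2] with s h1 h2
  exact h1.trans h2

/-- The play induced by a pair of strategies is unique up to a.e. equality. -/
theorem IsPlay.ae_unique {σA σB : Control r → Control r} (hA : IsStrategy σA)
    (hB : IsStrategy σB) {p q : Control r × Control r} (hp : IsPlay σA σB p)
    (hq : IsPlay σA σB q) :
    (∀ᵐ s : ℝ≥0, p.1 s = q.1 s) ∧ (∀ᵐ s : ℝ≥0, p.2 s = q.2 s) := by
  have h2 := (hB.comp hA).fixed_unique (hp.fixed hB) (hq.fixed hB)
  refine ⟨?_, h2⟩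
  filter_upwards [hA.congr h2, hp.1, hq.1] with s h3 h4 h5
  rw [← h4, ← h5, h3]

theorem edist_eq_zero_of_ae {f g : Control r} (h : ∀ᵐ s : ℝ≥0, f s = g s) : edist f g = 0 := by
  refine (lintegral_congr_ae (g := fun _ => 0) ?_).trans lintegral_zero
  filter_upwards [h] with s hs
  simp [hs]

theorem tendsto_of_agreeUpTo (hr : 0 < r) {F : ℕ → Control r} {f : Control r}
    (h : ∀ T : ℝ≥0, ∃ N, ∀ n, N ≤ n → AgreeUpTo T (F n) f) : Tendsto F atTop (𝓝 f) := by
  have hlim : Tendsto (fun n => edist (F n) f) atTop (𝓝 0) := by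
    have h0 : (0 : ℝ≥0∞) = ∫⁻ _ : ℝ≥0, 0 := by simp
    rw [h0]
    refine tendsto_lintegral_of_dominated_convergence
      (fun t => ENNReal.ofReal (discount r t)) (fun n => ?_) (fun n => ?_) ?_ ?_
    · refine Measurable.mul (by unfold discount; fun_prop) (Measurable.ite ?_ (by fun_prop)
        (by fun_prop))
      exact (measurableSet_eq_fun (F n).2 f.2).compl
    · refine Eventually.of_forall fun t => ?_
      dsimp only
      split_ifs <;> simp
    · exact (integrable_discount hr).lintegral_lt_top.ne
    · choose N hN using h
      have h2 : ∀ᵐ s : ℝ≥0, ∀ k : ℕ, ∀ n, N k ≤ n → s ≤ (k : ℝ≥0) → F n s = f s := by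
        refine ae_all_iff.2 fun k => ae_all_iff.2 fun n => ?_
        by_cases hn : N k ≤ n
        · filter_upwards [hN k n hn] with s hs _ using hs
        · exact Eventually.of_forall fun s h => absurd h hn
      filter_upwards [h2] with s hs
      obtain ⟨k, hk⟩ := exists_nat_ge s
      refine tendsto_const_nhds.congr' ?_
      filter_upwards [eventually_ge_atTop (N k)] with n hn
      simp [hs k n hn hk]
  exact tendsto_iff_edist_tendsto_0.2 hlim

/-- The play is a random variable. -/
theorem aemeasurable_play (hr : 0 < r) (μA : MixedStrategy.{u} r) (μB : MixedStrategy.{v} r) :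
    AEMeasurable (fun ω : μA.Ω × μB.Ω =>
      play (fun f => μA.act (ω.1, f)) (fun f => μB.act (ω.2, f))) (μA.P.prod μB.P) := by
  have hA : ∀ᵐ ω ∂(μA.P.prod μB.P), IsStrategy fun f => μA.act (ω.1, f) :=
    Measure.quasiMeasurePreserving_fst.ae μA.ae_isStrategy
  have hB : ∀ᵐ ω ∂(μA.P.prod μB.P), IsStrategy fun f => μB.act (ω.2, f) :=
    Measure.quasiMeasurePreserving_snd.ae μB.ae_isStrategy
  let F : ℕ → μA.Ω × μB.Ω → Control r := fun n ω =>
    ((fun f => μB.act (ω.2, f)) ∘ (fun f => μA.act (ω.1, f)))^[n] default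
  have hF : ∀ n, Measurable (F n) := by
    intro n
    induction n with
    | zero => exact measurable_const
    | succ n ih =>
      have : F (n + 1) = fun ω => μB.act (ω.2, μA.act (ω.1, F n ω)) := by
        funext ω
        simp only [F, Function.iterate_succ_apply', Function.comp]
      rw [this]
      exact μB.measurable_act.comp (measurable_snd.prodMk
        (μA.measurable_act.comp (measurable_fst.prodMk ih)))
  have h2 : AEMeasurable (fun ω : μA.Ω × μB.Ω =>
      (play (fun f => μA.act (ω.1, f)) (fun f => μB.act (ω.2, f))).2) (μA.P.prod μB.P) := by
    refine aemeasurable_of_tendsto_metrizable_ae atTop (fun n => (hF n).aemeasurable) ?_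
    filter_upwards [hA, hB] with ω h1 h2
    obtain ⟨f, hf, hlim⟩ := (h2.comp h1).exists_fixed default
    refine tendsto_of_agreeUpTo hr fun T => ?_
    obtain ⟨N, hN⟩ := hlim T
    refine ⟨N, fun n hn => (hN n hn).trans ?_⟩
    filter_upwards [(h2.comp h1).fixed_unique hf ((isPlay_play h1 h2).fixed h2)] with s hs _ using hs
  have h1 : AEMeasurable (fun ω : μA.Ω × μB.Ω =>
      (play (fun f => μA.act (ω.1, f)) (fun f => μB.act (ω.2, f))).1) (μA.P.prod μB.P) := by
    refine aemeasurable_of_tendsto_metrizable_ae (atTop : Filter ℕ)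
      (fun _ => μA.measurable_act.comp_aemeasurable (measurable_fst.aemeasurable.prodMk h2)) ?_
    filter_upwards [hA, hB] with ω h1 h2
    refine tendsto_of_agreeUpTo hr fun T => ⟨0, fun _ _ => ?_⟩
    filter_upwards [(isPlay_play h1 h2).1] with s hs _ using hs
  exact h1.prodMk h2

/-- A pair of mixed strategies induces a probability distribution over plays. -/
theorem isProbabilityMeasure_playLaw (hr : 0 < r) (μA : MixedStrategy.{u} r)
    (μB : MixedStrategy.{v} r) : IsProbabilityMeasure (playLaw μA μB) :=
  Measure.isProbabilityMeasure_map (aemeasurable_play hr μA μB)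

theorem integral_discount (hr : 0 < r) : ∫ t : ℝ≥0, discount r t = 1 := by
  have h1 : ∫ t : ℝ≥0, discount r t = ∫ t in Set.Ici (0 : ℝ), r * Real.exp (-r * t) :=
    integral_subtype_comap measurableSet_Ici fun t : ℝ => r * Real.exp (-r * t)
  rw [h1, integral_Ici_eq_integral_Ioi, integral_const_mul,
    integral_exp_mul_Ioi (by linarith) 0]
  simp [hr.ne']

theorem stagePayoff_mem_Icc (i : Player) (x y : Action) : stagePayoff i x y ∈ Set.Icc (0 : ℝ) 1 := by
  cases i <;> simp only [stagePayoff] <;> split_ifs <;> simp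

theorem payoff_mem_Icc (hr : 0 < r) (i : Player) (p : Control r × Control r) :
    payoff i p ∈ Set.Icc (0 : ℝ) 1 := by
  have h0 : ∀ t : ℝ≥0, 0 ≤ discount r t * stagePayoff i (p.1 t) (p.2 t) := fun t =>
    mul_nonneg (discount_nonneg hr t) (stagePayoff_mem_Icc i _ _).1
  refine ⟨integral_nonneg h0, ?_⟩
  rw [← integral_discount hr]
  exact integral_mono_of_nonneg (Eventually.of_forall h0) (integrable_discount hr)
    (Eventually.of_forall fun t =>
      mul_le_of_le_one_right (discount_nonneg hr t) (stagePayoff_mem_Icc i _ _).2)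

/-- Expected payoffs lie in `[0, 1]`; with `nonempty_mixedStrategy`, the infima and suprema in
`minmaxValue` are those of nonempty bounded sets of reals. -/
theorem expectedPayoff_mem_Icc (hr : 0 < r) (i : Player) (μA : MixedStrategy.{u} r)
    (μB : MixedStrategy.{v} r) : expectedPayoff i μA μB ∈ Set.Icc (0 : ℝ) 1 := by
  have := isProbabilityMeasure_playLaw hr μA μB
  refine ⟨integral_nonneg fun p => (payoff_mem_Icc hr i p).1, ?_⟩
  refine (integral_mono_of_nonneg (Eventually.of_forall fun p => (payoff_mem_Icc hr i p).1)
    (integrable_const 1) (Eventually.of_forall fun p => (payoff_mem_Icc hr i p).2)).trans ?_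
  simp

theorem nonempty_mixedStrategy (r : ℝ) : Nonempty (MixedStrategy.{u} r) :=
  ⟨Strategy.toMixed ⟨fun _ => default, measurable_const, fun n => (n : ℝ≥0), Nat.cast_zero,
    Nat.strictMono_cast, tendsto_natCast_atTop_atTop,
    fun _ _ _ _ => Eventually.of_forall fun _ _ => rfl⟩⟩

end MatchingPennies

end

/-! Bard follows Aqua by echoing her control with a small delay. For a fixed control this succeeds,
because translations act continuously on sets of finite measure. The difficulty is that Aqua reacts
to the echo, so her control depends on the delay, and her strategy's grid may be arbitrarily fine
depending on the sample point.

The delay is therefore allowed to vary: it is constant on each block of length `h` and chosen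
recursively (`exists_delay`). If no grid point lies inside a block, Aqua's control on it is
determined by what Bard played earlier, hence by delays already fixed. As a random control it does
not depend on the delay still to be chosen, so dominated convergence (`exists_small_delay`) gives a
delay with small expected mismatch. A block cut by a grid point costs at most `r * h`. Up to a time
`T` beyond which discounting leaves little weight, all but a small part of the probability has at
most `B` cut blocks, with `B` independent of `h` (`MixedStrategy.exists_grid_bound`,
`card_cutBlocks_le`). Taking `h` small after `T` and `B` makes `B * r * h` negligible.

The result is `exists_strategy_lintegral_edist_le`. Bard's payoff is one minus the distance between
the two controls, which gives his claim. Aqua's reduces to it by exchanging the two actions in her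
control. As payoffs never exceed 1, both minmax values are 1. -/

noncomputable section

namespace MatchingPennies

open Set symmDiff

variable {r : ℝ}

/-! ### The discounted measure and the space of controls -/

/-- The measure `r e^{-rt} dt` on `ℝ₊`. -/
def discountMeasure (r : ℝ) : Measure ℝ≥0 :=
  volume.withDensity fun t => ENNReal.ofReal (discount r t)

theorem measurable_discount : Measurable (discount r) := by
  unfold discount
  fun_prop

theorem discountMeasure_absolutelyContinuous : discountMeasure r ≪ volume :=
  withDensity_absolutelyContinuous _ _

theorem isProbabilityMeasure_discountMeasure (hr : 0 < r) :
    IsProbabilityMeasure (discountMeasure r) := by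
  constructor
  rw [discountMeasure, withDensity_apply _ MeasurableSet.univ, setLIntegral_univ,
    ← ofReal_integral_eq_lintegral_ofReal (integrable_discount hr)
      (Eventually.of_forall (discount_nonneg hr)), integral_discount hr, ENNReal.ofReal_one]

theorem discountMeasure_le (hr : 0 < r) (s : Set ℝ≥0) :
    discountMeasure r s ≤ ENNReal.ofReal r * volume s := by
  have h : discountMeasure r ≤ ENNReal.ofReal r • volume := by
    rw [discountMeasure, ← withDensity_const]
    refine withDensity_mono (Eventually.of_forall fun t => ENNReal.ofReal_le_ofReal ?_)
    have : Real.exp (-r * t) ≤ 1 := Real.exp_le_one_iff.2 (by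
      have := t.2
      nlinarith)
    unfold discount
    nlinarith
  exact h s

/-- The set of times at which two controls differ. -/
def Control.diffSet (f g : Control r) : Set ℝ≥0 := {t | f t ≠ g t}

theorem Control.measurableSet_diffSet (f g : Control r) : MeasurableSet (f.diffSet g) :=
  (measurableSet_eq_fun f.2 g.2).compl

theorem Control.diffSet_comm (f g : Control r) : f.diffSet g = g.diffSet f := by
  ext t
  exact ne_comm

theorem Control.diffSet_triangle (f g k : Control r) :
    f.diffSet k ⊆ f.diffSet g ∪ g.diffSet k := by
  intro t ht
  by_contra hcon
  simp only [diffSet, mem_union, mem_ofPred_eq, not_or, not_not] at hcon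
  exact ht (hcon.1.trans hcon.2)

theorem Control.edist_eq_measure (f g : Control r) :
    edist f g = discountMeasure r (f.diffSet g) := by
  rw [discountMeasure, withDensity_apply _ (f.measurableSet_diffSet g),
    ← lintegral_indicator (f.measurableSet_diffSet g)]
  refine lintegral_congr fun t => ?_
  by_cases h : f t = g t <;> simp [Control.diffSet, h]

/-- A control is the set of times at which it plays `true`, and the distance is the measure of a
symmetric difference, so a countable measure-dense family of sets suffices. Separability makes the
product σ-algebra on pairs of controls Borel, so that continuous functions of a pair are measurable.
-/
theorem separableSpace_control (hr : 0 < r) : TopologicalSpace.SeparableSpace (Control r) := by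
  have := isProbabilityMeasure_discountMeasure hr
  obtain ⟨𝒜, hc, hd⟩ := exists_countable_measureDense (discountMeasure r)
  classical
  let F : 𝒜 → Control r := fun s => ⟨fun t => decide (t ∈ s.1), measurable_to_bool (by
    convert hd.measurable s.1 s.2 using 1
    ext t
    simp)⟩
  have := hc.to_subtype
  refine ⟨range F, countable_range F, fun f => EMetric.mem_closure_iff.2 fun ε hε => ?_⟩
  obtain ⟨δ, hδ, hδε⟩ : ∃ δ : ℝ, 0 < δ ∧ ENNReal.ofReal δ ≤ ε := by
    rcases eq_or_ne ε ∞ with h | h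
    · exact ⟨1, one_pos, h ▸ le_top⟩
    · exact ⟨ε.toReal, ENNReal.toReal_pos hε.ne' h, ENNReal.ofReal_toReal_le⟩
  obtain ⟨s, hs, hlt⟩ := hd.approx (f.toFun ⁻¹' {true}) (f.2 (measurableSet_singleton _))
    (measure_ne_top _ _) δ hδ
  refine ⟨F ⟨s, hs⟩, mem_range_self _, ?_⟩
  rw [Control.edist_eq_measure]
  refine lt_of_le_of_lt (measure_mono fun t ht => ?_) (hlt.trans_le hδε)
  by_cases h : t ∈ s <;> cases h' : f.toFun t <;>
    simp_all [F, Control.diffSet, mem_symmDiff]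

theorem secondCountableTopology_control (hr : 0 < r) : SecondCountableTopology (Control r) := by
  have := separableSpace_control hr
  exact UniformSpace.secondCountable_of_separable (Control r)

theorem continuous_measure_inter_diffSet (S : Set ℝ≥0) :
    Continuous fun p : Control r × Control r => discountMeasure r (S ∩ p.1.diffSet p.2) := by
  refine continuous_of_le_add_edist 2 (by simp) fun p q => ?_
  have h : S ∩ p.1.diffSet p.2 ⊆
      S ∩ q.1.diffSet q.2 ∪ (p.1.diffSet q.1 ∪ p.2.diffSet q.2) := by
    rintro t ⟨hS, ht⟩
    rcases Control.diffSet_triangle _ q.1 _ ht with h | h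
    · exact Or.inr (Or.inl h)
    · rcases Control.diffSet_triangle _ q.2 _ h with h | h
      · exact Or.inl ⟨hS, h⟩
      · exact Or.inr (Or.inr (Control.diffSet_comm _ _ ▸ h))
  refine (measure_mono h).trans ((measure_union_le _ _).trans ?_)
  gcongr
  refine (measure_union_le _ _).trans ?_
  rw [← Control.edist_eq_measure, ← Control.edist_eq_measure, two_mul]
  gcongr
  exacts [le_max_left _ _, le_max_right _ _]

theorem measurable_measure_inter_diffSet (hr : 0 < r) (S : Set ℝ≥0) :
    Measurable fun p : Control r × Control r => discountMeasure r (S ∩ p.1.diffSet p.2) := by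
  have := secondCountableTopology_control hr
  exact (continuous_measure_inter_diffSet S).measurable

theorem measurable_edist_control (hr : 0 < r) :
    Measurable fun p : Control r × Control r => edist p.1 p.2 := by
  convert measurable_measure_inter_diffSet hr univ using 2 with p
  rw [univ_inter, Control.edist_eq_measure]

theorem edist_control_le_one (hr : 0 < r) (f g : Control r) : edist f g ≤ 1 := by
  have := isProbabilityMeasure_discountMeasure hr
  rw [Control.edist_eq_measure]
  exact prob_le_one

/-! ### Translations of `ℝ₊` -/

theorem volume_nnreal_apply (s : Set ℝ≥0) :
    (volume : Measure ℝ≥0) s = volume (((↑) : ℝ≥0 → ℝ) '' s) :=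
  comap_subtype_coe_apply (measurableSet_Ici (a := (0 : ℝ))) volume s

theorem volume_Ico_nnreal (a b : ℝ≥0) : volume (Ico a b) = ENNReal.ofReal (b - a) := by
  rw [volume_nnreal_apply, ← Real.volume_Ico]
  congr 1
  ext x
  constructor
  · rintro ⟨y, ⟨h1, h2⟩, rfl⟩
    exact ⟨h1, h2⟩
  · rintro ⟨h1, h2⟩
    exact ⟨⟨x, a.2.trans h1⟩, ⟨h1, h2⟩, rfl⟩

theorem map_add_right_volume_nnreal (d : ℝ≥0) :
    (volume : Measure ℝ≥0).map (· + d) = volume.restrict (Ici d) := by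
  ext s hs
  rw [Measure.map_apply (measurable_add_const d) hs, Measure.restrict_apply hs,
    volume_nnreal_apply, volume_nnreal_apply,
    ← measure_preimage_add_right volume (d : ℝ) (((↑) : ℝ≥0 → ℝ) '' (s ∩ Ici d))]
  congr 1
  ext x
  constructor
  · rintro ⟨y, hy, rfl⟩
    exact ⟨y + d, ⟨hy, mem_Ici.2 le_add_self⟩, by simp⟩
  · rintro ⟨y, ⟨hy, hdy⟩, hyx⟩
    refine ⟨y - d, by simpa [tsub_add_cancel_of_le (show d ≤ y from hdy)] using hy, ?_⟩
    rw [NNReal.coe_sub hdy]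
    linarith

theorem measurePreserving_sub_nnreal (d : ℝ≥0) :
    MeasurePreserving (· - d) (volume.restrict (Ici d)) (volume : Measure ℝ≥0) := by
  refine ⟨by fun_prop, ?_⟩
  rw [← map_add_right_volume_nnreal, Measure.map_map (by fun_prop) (by fun_prop)]
  convert Measure.map_id
  ext x
  simp

theorem ae_sub_of_ae {p : ℝ≥0 → Prop} (h : ∀ᵐ s : ℝ≥0, p s) (d : ℝ≥0) :
    ∀ᵐ s : ℝ≥0, d ≤ s → p (s - d) :=
  (ae_restrict_iff' measurableSet_Ici).1
    ((measurePreserving_sub_nnreal d).quasiMeasurePreserving.ae h)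

/-- Lebesgue measure is invariant under translation and the discount density decreases, so moving a
set to later times can only lower its weight. -/
theorem discountMeasure_preimage_sub_le (hr : 0 < r) (d : ℝ≥0) {s : Set ℝ≥0}
    (hs : MeasurableSet s) : discountMeasure r ({t | d ≤ t} ∩ (· - d) ⁻¹' s) ≤
      discountMeasure r s := by
  have hm : MeasurableSet ({t | d ≤ t} ∩ (· - d) ⁻¹' s) :=
    measurableSet_Ici.inter (hs.preimage (by fun_prop))
  have hd : Measurable fun t : ℝ≥0 => ENNReal.ofReal (discount r t) :=
    measurable_discount.ennreal_ofReal
  rw [discountMeasure, withDensity_apply _ hm, withDensity_apply _ hs,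
    ← lintegral_indicator hm, ← lintegral_indicator hs,
    ← (measurePreserving_sub_nnreal d).lintegral_comp (hd.indicator hs),
    ← lintegral_indicator measurableSet_Ici]
  refine lintegral_mono fun t => ?_
  by_cases hdt : d ≤ t <;> by_cases hts : t - d ∈ s <;> simp [hdt, hts, indicator]
  refine ENNReal.ofReal_le_ofReal (mul_le_mul_of_nonneg_left (Real.exp_le_exp.2 ?_) hr.le)
  have : ((t - d : ℝ≥0) : ℝ) ≤ t := NNReal.coe_le_coe.2 tsub_le_self
  nlinarith

/-! ### Delayed echoes -/

/-- The control that repeats the control `f` with the time-dependent delay `D`. -/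
def echo (D : SimpleFunc ℝ≥0 ℝ≥0) (f : Control r) : Control r where
  -- Until there is something to repeat, an arbitrary fixed action is played.
  toFun s := if s < D s then true else f (s - D s)
  measurable_toFun := Measurable.ite (measurableSet_lt measurable_id D.measurable)
    measurable_const (f.2.comp (measurable_id.sub D.measurable))

theorem echo_apply_of_le {D : SimpleFunc ℝ≥0 ℝ≥0} {f : Control r} {s : ℝ≥0} (h : D s ≤ s) :
    echo D f s = f (s - D s) := if_neg h.not_gt

theorem echo_apply_of_lt {D : SimpleFunc ℝ≥0 ℝ≥0} {f : Control r} {s : ℝ≥0} (h : s < D s) :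
    echo D f s = true := if_pos h

theorem echo_apply_congr {D D' : SimpleFunc ℝ≥0 ℝ≥0} {s : ℝ≥0} (h : D s = D' s)
    (f : Control r) : echo D f s = echo D' f s := by
  change (if s < D s then true else f (s - D s)) = if s < D' s then true else f (s - D' s)
  rw [h]

theorem diffSet_echo_subset (D : SimpleFunc ℝ≥0 ℝ≥0) (f g : Control r) :
    (echo D f).diffSet (echo D g) ⊆
      ⋃ d ∈ D.range, ({t | d ≤ t} ∩ (· - d) ⁻¹' f.diffSet g) := by
  intro t ht
  rcases lt_or_ge t (D t) with h | h
  · exact absurd ((echo_apply_of_lt h).trans (echo_apply_of_lt h).symm) ht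
  · simp only [Control.diffSet, mem_ofPred_eq, echo_apply_of_le h] at ht
    exact mem_iUnion₂.2 ⟨D t, D.mem_range_self t, h, ht⟩

/-- Each of the finitely many delays contributes at most one translated copy of the set where the
inputs differ, so the echo is Lipschitz, with the number of delays as constant. -/
theorem measurable_echo (hr : 0 < r) (D : SimpleFunc ℝ≥0 ℝ≥0) :
    Measurable (echo D : Control r → Control r) := by
  have h : LipschitzWith D.range.card (echo D : Control r → Control r) := fun f g => by
    rw [Control.edist_eq_measure, Control.edist_eq_measure]
    refine (measure_mono (diffSet_echo_subset D f g)).trans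
      ((measure_biUnion_finset_le _ _).trans ?_)
    refine (Finset.sum_le_sum fun d _ =>
      discountMeasure_preimage_sub_le hr d (f.measurableSet_diffSet g)).trans ?_
    simp
  exact h.continuous.measurable

theorem AgreeUpTo.echo {T c : ℝ≥0} {D : SimpleFunc ℝ≥0 ℝ≥0} {f g : Control r}
    (hc : ∀ s, c ≤ D s) (h : AgreeUpTo T f g) : AgreeUpTo (T + c) (echo D f) (echo D g) := by
  have h' : ∀ᵐ s : ℝ≥0, ∀ d ∈ D.range, d ≤ s → s - d ≤ T → f (s - d) = g (s - d) :=
    (D.range.eventually_all).2 fun d _ => ae_sub_of_ae h d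
  filter_upwards [h'] with s hs hsT
  rcases lt_or_ge s (D s) with hlt | hle
  · rw [echo_apply_of_lt hlt, echo_apply_of_lt hlt]
  · rw [echo_apply_of_le hle, echo_apply_of_le hle]
    refine hs _ (D.mem_range_self s) hle (tsub_le_iff_right.2 (hsT.trans ?_))
    gcongr
    exact hc s

/-- Finitely many positive delays have a positive minimum `c`, and the multiples of `c` form a grid.
-/
theorem isStrategy_echo (hr : 0 < r) {D : SimpleFunc ℝ≥0 ℝ≥0} (hD : ∀ s, 0 < D s) :
    IsStrategy (echo D : Control r → Control r) := by
  obtain ⟨c, hc0, hc⟩ : ∃ c : ℝ≥0, 0 < c ∧ ∀ s, c ≤ D s := by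
    have hne : D.range.Nonempty := ⟨D 0, D.mem_range_self 0⟩
    refine ⟨D.range.min' hne, ?_, fun s => Finset.min'_le _ _ (D.mem_range_self s)⟩
    obtain ⟨s, hs⟩ := SimpleFunc.mem_range.1 (D.range.min'_mem hne)
    exact hs ▸ hD s
  refine ⟨measurable_echo hr D, fun n => n * c, by simp, fun m n hmn => ?_, ?_,
    fun n f g hfg => ?_⟩
  · dsimp only
    gcongr
  · exact (tendsto_natCast_atTop_atTop (R := ℝ≥0)).atTop_mul_const hc0
  · have := hfg.echo hc
    rwa [← add_one_mul, ← Nat.cast_add_one] at this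

/-- This is continuity of translation, applied to the set of times before `T` at which `f` plays
`true`, moved to the real line. The cut at `T` makes its Lebesgue measure finite; the initial
stretch of length `d` is counted separately. -/
theorem tendsto_measure_diffSet_echo_const (hr : 0 < r) (T : ℝ≥0) (f : Control r) :
    Tendsto (fun d : ℝ≥0 =>
      discountMeasure r (Iio T ∩ f.diffSet (echo (SimpleFunc.const _ d) f))) (𝓝 0) (𝓝 0) := by
  let A : Set ℝ := ((↑) : ℝ≥0 → ℝ) '' (Iio T ∩ f.toFun ⁻¹' {true})
  have hA : MeasurableSet A := (MeasurableEmbedding.subtype_coe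
    (measurableSet_Ici (a := (0 : ℝ)))).measurableSet_image.2
      (measurableSet_Iio.inter (f.2 (measurableSet_singleton _)))
  have hAfin : volume A ≠ ∞ := by
    refine ne_top_of_le_ne_top ?_ (measure_mono (t := Icc (0 : ℝ) T) ?_)
    · simp
    · rintro _ ⟨s, ⟨hs, -⟩, rfl⟩
      exact ⟨s.2, (NNReal.coe_lt_coe.2 hs).le⟩
  let F : ℝ≥0 → C(ℝ, ℝ) := fun d => ⟨fun x => x - d, by fun_prop⟩
  have hF : Continuous F := ContinuousMap.continuous_of_continuous_uncurry _ (by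
    change Continuous fun p : ℝ≥0 × ℝ => p.2 - (p.1 : ℝ)
    fun_prop)
  have h1 := tendsto_measure_symmDiff_preimage_nhds_zero (μ := volume) (ν := volume) (hF.tendsto 0)
    (Eventually.of_forall fun d => measurePreserving_sub_right volume (d : ℝ))
    (measurePreserving_sub_right volume _) hA.nullMeasurableSet hAfin
  have h2 : Tendsto (fun d : ℝ≥0 => ENNReal.ofReal r *
      (volume ((F d ⁻¹' A) ∆ (F 0 ⁻¹' A)) + ENNReal.ofReal d)) (𝓝 0) (𝓝 0) := by
    have h3 : Tendsto (fun d : ℝ≥0 => ENNReal.ofReal d) (𝓝 0) (𝓝 0) := by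
      have : Continuous fun d : ℝ≥0 => ENNReal.ofReal d :=
        ENNReal.continuous_ofReal.comp NNReal.continuous_coe
      simpa using this.tendsto 0
    simpa using ENNReal.Tendsto.const_mul (h1.add h3) (Or.inr ENNReal.ofReal_ne_top)
  refine tendsto_of_tendsto_of_tendsto_of_le_of_le tendsto_const_nhds h2 (fun _ => zero_le)
    fun d => (discountMeasure_le hr _).trans ?_
  gcongr
  have hsub : Iio T ∩ f.diffSet (echo (SimpleFunc.const _ d) f) ⊆
      ((↑) : ℝ≥0 → ℝ) ⁻¹' ((F d ⁻¹' A) ∆ (F 0 ⁻¹' A)) ∪ Ico 0 d := by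
    rintro s ⟨hsT, hs⟩
    rcases lt_or_ge s d with hsd | hsd
    · exact Or.inr ⟨zero_le, hsd⟩
    · refine Or.inl ?_
      rw [Control.diffSet, mem_ofPred_eq, echo_apply_of_le (by simpa using hsd)] at hs
      have hmem : ∀ t : ℝ≥0, (t : ℝ) ∈ A ↔ t < T ∧ f t = true := fun t => by
        rw [show A = ((↑) : ℝ≥0 → ℝ) '' (Iio T ∩ f.toFun ⁻¹' {true}) from rfl,
          NNReal.coe_injective.mem_set_image]
        rfl
      have e1 : F d (s : ℝ) = ((s - d : ℝ≥0) : ℝ) := (NNReal.coe_sub hsd).symm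
      have e2 : F 0 (s : ℝ) = (s : ℝ) := by simp [F]
      have hlt : s - d < T := lt_of_le_of_lt tsub_le_self hsT
      rw [mem_preimage, mem_symmDiff, mem_preimage, mem_preimage, e1, e2, hmem, hmem]
      have hsT' : s < T := hsT
      simp only [hlt, hsT', true_and]
      simp only [SimpleFunc.const_apply] at hs
      revert hs
      cases f s <;> cases f (s - d) <;> simp
  refine (measure_mono hsub).trans ((measure_union_le _ _).trans ?_)
  rw [volume_Ico_nnreal]
  refine add_le_add ?_ (by simp)
  rw [volume_nnreal_apply]
  exact measure_mono (image_preimage_subset _ _)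

/-! ### Time grids and causality -/

/-- A time grid witnessing that `σ` acts with delay. -/
def IsGrid (σ : Control r → Control r) (t : ℕ → ℝ≥0) : Prop :=
  t 0 = 0 ∧ StrictMono t ∧ Tendsto t atTop atTop ∧
    ∀ n, ∀ f g : Control r, AgreeUpTo (t n) f g → AgreeUpTo (t (n + 1)) (σ f) (σ g)

theorem IsGrid.exists_mem_Ico {σ : Control r → Control r} {t : ℕ → ℝ≥0} (ht : IsGrid σ t)
    (T : ℝ≥0) : ∃ n, t n ≤ T ∧ T < t (n + 1) := by
  obtain ⟨ht0, -, htt, -⟩ := ht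
  have hex : ∃ n, T < t n := (htt.eventually_gt_atTop T).exists
  have hspec := Nat.find_spec hex
  obtain ⟨n, hn⟩ : ∃ n, Nat.find hex = n + 1 := Nat.exists_eq_succ_of_ne_zero fun h => by
    rw [h, ht0] at hspec
    exact not_lt_zero hspec
  exact ⟨n, not_lt.1 (Nat.find_min hex (hn ▸ Nat.lt_succ_self n)), hn ▸ hspec⟩

/-- If two strategies give the same answers up to time `T`, so do the plays they induce against a
given opponent. -/
theorem IsPlay.agreeUpTo_snd {σ τ τ' : Control r → Control r} (hσ : IsStrategy σ)
    (hτ : IsStrategy τ) (hτ' : IsStrategy τ') {T : ℝ≥0} (h : ∀ f, AgreeUpTo T (τ f) (τ' f))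
    {p q : Control r × Control r} (hp : IsPlay σ τ p) (hq : IsPlay σ τ' q) :
    AgreeUpTo T p.2 q.2 := by
  obtain ⟨-, t, ht⟩ := hτ.comp hσ
  -- Both second components are fixed points, of `τ ∘ σ` and `τ' ∘ σ`. Agreement spreads along the
  -- grid of the first map until `T`, where the two answers may part.
  have key : ∀ n, AgreeUpTo (min T (t n)) p.2 q.2 := by
    intro n
    induction n with
    | zero =>
      rw [ht.1, min_eq_right zero_le]
      exact agreeUpTo_zero _ _
    | succ n ih =>
      rcases le_total (t n) T with hle | hle
      · rw [min_eq_right hle] at ih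
        filter_upwards [ht.2.2.2 n _ _ ih, h (σ q.2), hp.fixed hτ, hq.fixed hτ']
          with s h1 h2 h3 h4 hs
        rw [← h3, ← h4, h1 (hs.trans (min_le_right _ _))]
        exact h2 (hs.trans (min_le_left _ _))
      · rw [min_eq_left hle] at ih
        exact ih.mono (min_le_left _ _)
  obtain ⟨n, hn⟩ := (ht.2.2.1.eventually_ge_atTop T).exists
  simpa [min_eq_left hn] using key n

theorem agreeUpTo_echo_of_eqOn {D D' : SimpleFunc ℝ≥0 ℝ≥0} {T : ℝ≥0}
    (h : ∀ s < T, D s = D' s) (f : Control r) : AgreeUpTo T (echo D f) (echo D' f) := by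
  have h0 : (volume : Measure ℝ≥0) {T} = 0 := by
    rw [volume_nnreal_apply, image_singleton, Real.volume_singleton]
  filter_upwards [measure_eq_zero_iff_ae_notMem.1 h0] with s hs hsT
  exact echo_apply_congr (h s (lt_of_le_of_ne hsT hs)) f

open Classical in
/-- The blocks `[kh, (k+1)h]`, `k < n`, with a point of the grid `t` in their interior. -/
def cutBlocks (h : ℝ≥0) (t : ℕ → ℝ≥0) (n : ℕ) : Finset ℕ :=
  (Finset.range n).filter fun k => ∃ i, k * h < t i ∧ t i < (k + 1) * h

theorem card_cutBlocks_le {h : ℝ≥0} (hh : 0 < h) {t : ℕ → ℝ≥0} (ht : StrictMono t) {n B : ℕ}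
    (hB : n * h ≤ t B) : (cutBlocks h t n).card ≤ B := by
  classical
  -- A grid point determines the block it cuts, and those cutting one of these blocks come before `t
  -- B`.
  have hsub : cutBlocks h t n ⊆ (Finset.range B).image fun i => ⌊t i / h⌋₊ := by
    intro k hk
    obtain ⟨hkn, i, hi, hi'⟩ := Finset.mem_filter.1 hk
    have hkn' : ((k : ℝ≥0) + 1) ≤ n := by exact_mod_cast Finset.mem_range.1 hkn
    refine Finset.mem_image.2 ⟨i, Finset.mem_range.2 (ht.lt_iff_lt.1 ?_), ?_⟩
    · exact hi'.trans_le (le_trans (by gcongr) hB)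
    · rw [Nat.floor_eq_iff zero_le]
      exact ⟨(le_div_iff₀ hh).2 hi.le, (div_lt_iff₀ hh).2 hi'⟩
  exact (Finset.card_le_card hsub).trans (Finset.card_image_le.trans (by simp))

/-! ### The random play against a pure strategy -/

theorem aemeasurable_play_left (hr : 0 < r) (μ : MixedStrategy.{u} r) (σ : Strategy r) :
    AEMeasurable (fun ω : μ.Ω => play (fun f => μ.act (ω, f)) σ.1) μ.P := by
  have h := aemeasurable_play hr μ (Strategy.toMixed.{0} σ)
  have hP : μ.P.prod (Strategy.toMixed.{0} σ).P = μ.P.map fun ω => (ω, PUnit.unit) :=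
    Measure.prod_dirac _
  rw [hP] at h
  exact h.comp_measurable (measurable_id.prodMk measurable_const)

theorem aemeasurable_measure_inter_diffSet_echo (hr : 0 < r) {Ω : Type u} [MeasurableSpace Ω]
    {P : Measure Ω} {F : Ω → Control r} (hF : AEMeasurable F P) (S : Set ℝ≥0)
    (D : SimpleFunc ℝ≥0 ℝ≥0) :
    AEMeasurable (fun ω => discountMeasure r (S ∩ (F ω).diffSet (echo D (F ω)))) P := by
  have h : AEMeasurable (fun ω => (F ω, echo D (F ω))) P :=
    hF.prodMk ((measurable_echo hr D).comp_aemeasurable hF)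
  have h' := (measurable_measure_inter_diffSet hr S).comp_aemeasurable h
  exact h'

/-- The random control `F` does not react to `d`, so the pointwise limit as `d` tends to zero passes
under the expectation by dominated convergence. -/
theorem exists_small_delay (hr : 0 < r) (μ : MixedStrategy.{u} r) {F : μ.Ω → Control r}
    (hF : AEMeasurable F μ.P) (T : ℝ≥0) {ε : ℝ≥0∞} (hε : ε ≠ 0) :
    ∃ d : ℝ≥0, 0 < d ∧ ∫⁻ ω, discountMeasure r
      (Iio T ∩ (F ω).diffSet (echo (SimpleFunc.const _ d) (F ω))) ∂μ.P ≤ ε := by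
  have := isProbabilityMeasure_discountMeasure hr
  let Q : ℝ≥0 → μ.Ω → ℝ≥0∞ := fun d ω => discountMeasure r
    (Iio T ∩ (F ω).diffSet (echo (SimpleFunc.const _ d) (F ω)))
  have hQm : ∀ d, AEMeasurable (Q d) μ.P := fun d =>
    aemeasurable_measure_inter_diffSet_echo hr hF _ _
  have hQ1 : ∀ d ω, Q d ω ≤ 1 := fun d ω => prob_le_one
  have hQlim : ∀ ω, Tendsto (fun d => Q d ω) (𝓝[>] 0) (𝓝 0) := fun ω =>
    (tendsto_measure_diffSet_echo_const hr T (F ω)).mono_left nhdsWithin_le_nhds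
  have hlim : Tendsto (fun d : ℝ≥0 => ∫⁻ ω, Q d ω ∂μ.P) (𝓝[>] 0) (𝓝 (∫⁻ _, 0 ∂μ.P)) :=
    tendsto_lintegral_filter_of_dominated_convergence' (fun _ => 1)
      (Eventually.of_forall hQm) (Eventually.of_forall fun d => Eventually.of_forall (hQ1 d))
      (by simp) (Eventually.of_forall hQlim)
  rw [lintegral_zero] at hlim
  obtain ⟨d, hd, hd0⟩ := ((hlim.eventually_le_const (pos_iff_ne_zero.2 hε)).and
    self_mem_nhdsWithin).exists
  exact ⟨d, hd0, hd⟩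

/-- Delays can be chosen block by block, so that the echo is close to the control it repeats on
all blocks that are not cut by the grid of the opponent. -/
theorem exists_delay (hr : 0 < r) (μ : MixedStrategy.{u} r) (h : ℝ≥0) {ε : ℝ≥0∞} (hε : ε ≠ 0)
    (n : ℕ) : ∃ (D : SimpleFunc ℝ≥0 ℝ≥0) (R : μ.Ω → ℝ≥0∞), (∀ s, 0 < D s) ∧
      AEMeasurable R μ.P ∧ ∫⁻ ω, R ω ∂μ.P ≤ n * ε ∧
      ∀ ω, ∀ D' : SimpleFunc ℝ≥0 ℝ≥0, (∀ s, 0 < D' s) → (∀ s < n * h, D' s = D s) →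
        ∀ t, IsGrid (fun f => μ.act (ω, f)) t → ∀ p, IsPlay (fun f => μ.act (ω, f)) (echo D') p →
          discountMeasure r (Iio (n * h) ∩ p.1.diffSet p.2) ≤
            R ω + (cutBlocks h t n).card * ENNReal.ofReal (r * h) := by
  induction n with
  | zero =>
    refine ⟨SimpleFunc.const _ 1, fun _ => 0, by simp, aemeasurable_const, by simp,
      fun ω D' _ _ t _ p _ => ?_⟩
    have : Iio (((0 : ℕ) : ℝ≥0) * h) = ∅ := by
      ext s
      simp
    rw [this, empty_inter, measure_empty]
    exact zero_le
  | succ n ih =>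
    classical
    obtain ⟨D, R, hD, hRm, hR, hmain⟩ := ih
    -- This is the opponent's control against the delays chosen so far. `D` also prescribes delays
    -- from `n * h` on, but on an uncut block these do not influence it.
    let F : μ.Ω → Control r := fun ω => (play (fun f => μ.act (ω, f)) (echo D)).1
    have hF : AEMeasurable F μ.P :=
      measurable_fst.comp_aemeasurable (aemeasurable_play_left hr μ ⟨_, isStrategy_echo hr hD⟩)
    obtain ⟨d, hd, hdε⟩ := exists_small_delay hr μ hF ((n + 1 : ℕ) * h) hε
    let Q : μ.Ω → ℝ≥0∞ := fun ω => discountMeasure r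
      (Iio ((n + 1 : ℕ) * h) ∩ (F ω).diffSet (echo (SimpleFunc.const _ d) (F ω)))
    have hQ : AEMeasurable Q μ.P := aemeasurable_measure_inter_diffSet_echo hr hF _ _
    refine ⟨SimpleFunc.piecewise (Iio (n * h)) measurableSet_Iio D (SimpleFunc.const _ d),
      fun ω => R ω + Q ω, fun s => ?_, hRm.add hQ, ?_, fun ω D' hD' hDD' t ht p hp => ?_⟩
    · by_cases hs : s < n * h <;> simp [SimpleFunc.piecewise_apply, hs, hD, hd]
    · rw [lintegral_add_left' hRm, Nat.cast_add_one, add_one_mul]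
      exact add_le_add hR hdε
    · have hle : (n : ℝ≥0) * h ≤ (n + 1 : ℕ) * h := by gcongr; exact n.le_succ
      have hD'1 : ∀ s < n * h, D' s = D s := fun s hs => by
        rw [hDD' s (hs.trans_le hle)]
        simp [SimpleFunc.piecewise_apply, hs]
      have hD'2 : ∀ s < (n + 1 : ℕ) * h, n * h ≤ s → D' s = SimpleFunc.const _ d s :=
        fun s hs hs' => by
          rw [hDD' s hs]
          simp [SimpleFunc.piecewise_apply, hs'.not_gt]
      have hσ : IsStrategy fun f => μ.act (ω, f) :=
        ⟨μ.measurable_act.comp measurable_prodMk_left, t, ht⟩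
      -- The induction hypothesis covers every continuation of the earlier delays, so it applies to
      -- the play against `D'` itself.
      have hold := hmain ω D' hD' hD'1 t ht p hp
      have hsplit : Iio ((n + 1 : ℕ) * h) ∩ p.1.diffSet p.2 ⊆
          Iio (n * h) ∩ p.1.diffSet p.2 ∪ Ico (n * h) ((n + 1 : ℕ) * h) ∩ p.1.diffSet p.2 := by
        rintro s ⟨hs, hs'⟩
        rcases lt_or_ge s (n * h) with hlt | hge
        · exact Or.inl ⟨hlt, hs'⟩
        · exact Or.inr ⟨⟨hge, hs⟩, hs'⟩
      refine (measure_mono hsplit).trans ((measure_union_le _ _).trans ?_)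
      by_cases hcut : ∃ i, n * h < t i ∧ t i < (n + 1) * h
      · have hcard : (cutBlocks h t (n + 1)).card = (cutBlocks h t n).card + 1 := by
          rw [cutBlocks, Finset.range_add_one, Finset.filter_insert, if_pos hcut,
            Finset.card_insert_of_notMem (by simp)]
          rfl
        have hblock : discountMeasure r (Ico (n * h) ((n + 1 : ℕ) * h) ∩ p.1.diffSet p.2) ≤
            ENNReal.ofReal (r * h) := by
          refine (measure_mono inter_subset_left).trans ((discountMeasure_le hr _).trans ?_)
          rw [volume_Ico_nnreal, ENNReal.ofReal_mul hr.le]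
          gcongr
          push_cast
          linarith
        rw [hcard, Nat.cast_add_one (R := ℝ≥0∞), add_one_mul, ← add_assoc]
        refine add_le_add (hold.trans ?_) hblock
        gcongr
        exact le_self_add
      · have hcard : (cutBlocks h t (n + 1)).card = (cutBlocks h t n).card := by
          rw [cutBlocks, Finset.range_add_one, Finset.filter_insert, if_neg hcut]
          rfl
        rw [hcard, add_right_comm]
        refine add_le_add hold ?_
        have hτ := isStrategy_echo hr hD
        have hq := isPlay_play hσ hτ
        have hpq := hp.agreeUpTo_snd hσ (isStrategy_echo hr hD') hτ
          (agreeUpTo_echo_of_eqOn hD'1) hq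
        -- The last grid point up to `n * h` is `t m`. As the block is uncut, the next one lies at
        -- or beyond its end, so the opponent's control on the whole block depends only on play up
        -- to `t m`.
        obtain ⟨m, hm, hm'⟩ := ht.exists_mem_Ico (n * h)
        have hm'' : ((n + 1 : ℕ) : ℝ≥0) * h ≤ t (m + 1) := by
          by_contra hcon
          exact hcut ⟨m + 1, hm', by simpa using hcon⟩
        have hfst : AgreeUpTo ((n + 1 : ℕ) * h) p.1 (F ω) := by
          filter_upwards [ht.2.2.2 m _ _ (hpq.mono hm), hp.1, hq.1] with s h1 h2 h3 hs
          rw [← h2, h1 (hs.trans hm''), h3]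
        have hecho := hfst.echo (c := 0) (D := SimpleFunc.const _ d) fun _ => zero_le
        refine measure_mono_ae (discountMeasure_absolutelyContinuous.ae_le ?_)
        filter_upwards [hfst, hecho, hp.2] with s h1 h2 h3
        rintro ⟨⟨hs, hs'⟩, hne⟩
        refine ⟨hs', fun heq => hne ?_⟩
        rw [h1 hs'.le, ← h3, echo_apply_congr (hD'2 s hs' hs), h2 (by simpa using hs'.le), heq]

theorem exists_discountMeasure_Ici_le (hr : 0 < r) {ε : ℝ≥0∞} (hε : ε ≠ 0) :
    ∃ T : ℕ, discountMeasure r (Ici (T : ℝ≥0)) ≤ ε := by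
  have := isProbabilityMeasure_discountMeasure hr
  have hlim := tendsto_measure_iInter_atTop (μ := discountMeasure r)
    (s := fun T : ℕ => Ici (T : ℝ≥0)) (fun _ => measurableSet_Ici.nullMeasurableSet)
    (fun m n hmn => Ici_subset_Ici.2 (by exact_mod_cast hmn)) ⟨0, measure_ne_top _ _⟩
  have hempty : ⋂ T : ℕ, Ici (T : ℝ≥0) = ∅ := by
    refine eq_empty_of_forall_notMem fun s hs => ?_
    obtain ⟨n, hn⟩ := exists_nat_gt s
    exact (mem_iInter.1 hs n).not_gt hn
  rw [hempty, measure_empty] at hlim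
  exact (hlim.eventually_le_const (pos_iff_ne_zero.2 hε)).exists

/-- With probability close to one, few grid points are needed to reach a given time. -/
theorem MixedStrategy.exists_grid_bound (μ : MixedStrategy.{u} r) (T : ℝ≥0) {ε : ℝ≥0∞}
    (hε : ε ≠ 0) :
    ∃ B : ℕ, 1 - ε < μ.P {ω | ∃ t, IsGrid (fun f => μ.act (ω, f)) t ∧ T ≤ t B} := by
  let G : ℕ → Set μ.Ω := fun B => {ω | ∃ t, IsGrid (fun f => μ.act (ω, f)) t ∧ T ≤ t B}
  have hmono : Monotone G := by
    rintro m n hmn ω ⟨t, ht, hT⟩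
    exact ⟨t, ht, hT.trans (ht.2.1.monotone hmn)⟩
  have hone : μ.P (⋃ B, G B) = 1 := by
    rw [← measure_univ (μ := μ.P)]
    refine measure_congr (eventuallyEq_univ.2 ?_)
    filter_upwards [μ.ae_isStrategy] with ω hω
    obtain ⟨-, t, ht⟩ := hω
    obtain ⟨B, hB⟩ := (ht.2.2.1.eventually_ge_atTop T).exists
    exact mem_iUnion.2 ⟨B, t, ht, hB⟩
  -- The sets `G B` need not be measurable; continuity from below along an increasing sequence holds
  -- for outer measure.
  rw [hmono.measure_iUnion] at hone
  refine lt_iSup_iff.1 (hone.symm ▸ ?_)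
  exact ENNReal.sub_lt_self ENNReal.one_ne_top one_ne_zero hε

/-- Some pure strategy follows a given mixed strategy closely. -/
theorem exists_strategy_lintegral_edist_le (hr : 0 < r) (μ : MixedStrategy.{u} r) {ε : ℝ≥0∞}
    (hε : ε ≠ 0) : ∃ σ : Strategy r,
      ∫⁻ ω, edist (play (fun f => μ.act (ω, f)) σ.1).1 (play (fun f => μ.act (ω, f)) σ.1).2 ∂μ.P
        ≤ ε := by
  -- There are four sources of error: the delays, the cut blocks, the times after `T`, and the
  -- sample points whose grid is too fine.
  have hη : ε / 4 ≠ 0 := (ENNReal.div_pos hε (by simp)).ne'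
  set η := ε / 4 with hηdef
  obtain ⟨T, hT⟩ := exists_discountMeasure_Ici_le hr hη
  obtain ⟨B, hB⟩ := μ.exists_grid_bound T hη
  obtain ⟨m, hm0, hm⟩ : ∃ m : ℕ, 0 < m ∧ B * ENNReal.ofReal (r * (m : ℝ≥0)⁻¹) ≤ η := by
    have h1 : Tendsto (fun m : ℕ => B * ENNReal.ofReal (r * ((m : ℝ≥0)⁻¹ : ℝ≥0))) atTop
        (𝓝 (B * ENNReal.ofReal (r * (0 : ℝ≥0)))) :=
      ENNReal.Tendsto.const_mul (ENNReal.tendsto_ofReal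
        ((NNReal.tendsto_coe.2 (tendsto_inv_atTop_nhds_zero_nat (𝕜 := ℝ≥0))).const_mul r))
        (Or.inr (ENNReal.natCast_ne_top B))
    simp only [NNReal.coe_zero, mul_zero, ENNReal.ofReal_zero] at h1
    obtain ⟨m, h2, h3⟩ := ((h1.eventually_le_const (pos_iff_ne_zero.2 hη)).and
      (eventually_gt_atTop 0)).exists
    exact ⟨m, h3, by simpa using h2⟩
  -- `T * m` blocks of length `1 / m` fill `[0, T]`. If `T = 0`, the error per block is `η / 0 = ∞`,
  -- which is harmless as there are no blocks.
  obtain ⟨D, R, hD, hRm, hR, hmain⟩ := exists_delay hr μ (m : ℝ≥0)⁻¹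
    (ε := η / (T * m : ℕ)) (ENNReal.div_pos hη (ENNReal.natCast_ne_top _)).ne' (T * m)
  have hh : 0 < (m : ℝ≥0)⁻¹ := by positivity
  have hTm : ((T * m : ℕ) : ℝ≥0) * (m : ℝ≥0)⁻¹ = T := by
    rw [Nat.cast_mul, mul_assoc, mul_inv_cancel₀ (by positivity), mul_one]
  rw [hTm] at hmain
  have hσ := isStrategy_echo hr hD
  refine ⟨⟨echo D, hσ⟩, ?_⟩
  set p : μ.Ω → Control r × Control r := fun ω => play (fun f => μ.act (ω, f)) (echo D)
  let a : μ.Ω → ℝ≥0∞ := fun ω => edist (p ω).1 (p ω).2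
  have ha : AEMeasurable a μ.P :=
    (measurable_edist_control hr).comp_aemeasurable (aemeasurable_play_left hr μ ⟨_, hσ⟩)
  -- The exceptional event is defined by failure of the final estimate rather than by the grids,
  -- which makes it null measurable. Its complement contains the possibly nonmeasurable set of
  -- sample points with few grid points.
  let M : Set μ.Ω := {ω | R ω + (η + η) < a ω}
  have hM : NullMeasurableSet M μ.P := nullMeasurableSet_lt (hRm.add_const _) ha
  have hMle : μ.P M ≤ η := by
    have hsub : {ω | ∃ t, IsGrid (fun f => μ.act (ω, f)) t ∧ (T : ℝ≥0) ≤ t B} ⊆ Mᶜ := by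
      rintro ω ⟨t, ht, hTB⟩
      change ¬R ω + (η + η) < a ω
      refine not_lt.2 ?_
      have hplay : IsPlay (fun f => μ.act (ω, f)) (echo D) (p ω) :=
        isPlay_play ⟨μ.measurable_act.comp measurable_prodMk_left, t, ht⟩ hσ
      have h1 := hmain ω D hD (fun _ _ => rfl) t ht (p ω) hplay
      have h2 : ((cutBlocks (m : ℝ≥0)⁻¹ t (T * m)).card : ℝ≥0∞) ≤ B := by
        exact_mod_cast card_cutBlocks_le hh ht.2.1 (hTm ▸ hTB)
      have h3 : (p ω).1.diffSet (p ω).2 ⊆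
          Iio (T : ℝ≥0) ∩ (p ω).1.diffSet (p ω).2 ∪ Ici (T : ℝ≥0) := fun s hs =>
        (lt_or_ge s T).imp (fun h => ⟨h, hs⟩) id
      rw [show a ω = _ from Control.edist_eq_measure _ _, ← add_assoc]
      refine (measure_mono h3).trans ((measure_union_le _ _).trans (add_le_add (h1.trans ?_) hT))
      gcongr
      refine le_trans ?_ hm
      gcongr
    rw [← compl_compl M, prob_compl_eq_one_sub₀ hM.compl]
    exact (tsub_le_tsub_left (hB.le.trans (measure_mono hsub)) 1).trans tsub_tsub_le
  have hbound : ∀ ω, a ω ≤ (R ω + (η + η)) + M.indicator (fun _ => 1) ω := by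
    intro ω
    by_cases hω : ω ∈ M
    · rw [indicator_of_mem hω]
      exact (edist_control_le_one hr _ _).trans le_add_self
    · exact (not_lt.1 hω).trans le_self_add
  calc ∫⁻ ω, a ω ∂μ.P ≤ ∫⁻ ω, (R ω + (η + η)) + M.indicator (fun _ => 1) ω ∂μ.P :=
        lintegral_mono hbound
    _ = ∫⁻ ω, R ω ∂μ.P + (η + η) + μ.P M := by
        rw [lintegral_add_left' (hRm.add_const _), lintegral_add_left' hRm, lintegral_const,
          measure_univ, mul_one, lintegral_indicator_const₀ hM, one_mul]
    _ ≤ η + (η + η) + η := by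
        gcongr
        exact hR.trans ENNReal.mul_div_le
    _ = ε := by
        rw [show η + (η + η) + η = 4 * η by ring, hηdef]
        exact ENNReal.mul_div_cancel (by simp) (by simp)

/-! ### Exchanging the two actions -/

/-- The control with the two actions exchanged. -/
def Control.flip (f : Control r) : Control r := ⟨fun t => !f t, (measurable_of_finite not).comp f.2⟩

theorem Control.flip_apply (f : Control r) (t : ℝ≥0) : f.flip t = !f t := rfl

theorem Control.diffSet_flip (f g : Control r) : f.flip.diffSet g.flip = f.diffSet g := by
  ext t
  simp [diffSet, flip_apply]

theorem Control.measurable_flip : Measurable (Control.flip : Control r → Control r) := by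
  have h : Isometry (Control.flip : Control r → Control r) := fun f g => by
    rw [edist_eq_measure, edist_eq_measure, diffSet_flip]
  exact h.continuous.measurable

theorem AgreeUpTo.flip {T : ℝ≥0} {f g : Control r} (h : AgreeUpTo T f g) :
    AgreeUpTo T f.flip g.flip := by
  filter_upwards [h] with s hs hsT
  rw [Control.flip_apply, Control.flip_apply, hs hsT]

theorem IsStrategy.flip_comp {σ : Control r → Control r} (hσ : IsStrategy σ) :
    IsStrategy fun f => (σ f).flip := by
  obtain ⟨hm, t, h0, h1, h2, h3⟩ := hσ
  exact ⟨Control.measurable_flip.comp hm, t, h0, h1, h2, fun n f g h => (h3 n f g h).flip⟩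

theorem IsStrategy.comp_flip {σ : Control r → Control r} (hσ : IsStrategy σ) :
    IsStrategy fun f => σ f.flip := by
  obtain ⟨hm, t, h0, h1, h2, h3⟩ := hσ
  exact ⟨hm.comp Control.measurable_flip, t, h0, h1, h2, fun n f g h => h3 n _ _ h.flip⟩

/-- The mixed strategy that answers to the control with the two actions exchanged. -/
def MixedStrategy.compFlip (μ : MixedStrategy.{u} r) : MixedStrategy.{u} r where
  Ω := μ.Ω
  P := μ.P
  act p := μ.act (p.1, p.2.flip)
  measurable_act := μ.measurable_act.comp
    (measurable_fst.prodMk (Control.measurable_flip.comp measurable_snd))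
  ae_isStrategy := by
    filter_upwards [μ.ae_isStrategy] with ω hω using hω.comp_flip

/-! ### Payoffs -/

theorem payoff_bard (hr : 0 < r) (p : Control r × Control r) :
    payoff .bard p = 1 - (edist p.1 p.2).toReal := by
  have hm : Measurable fun t : ℝ≥0 => if p.1 t ≠ p.2 t then (1 : ℝ) else 0 :=
    Measurable.ite (p.1.measurableSet_diffSet p.2) measurable_const measurable_const
  have hint : Integrable fun t : ℝ≥0 => discount r t * (if p.1 t ≠ p.2 t then 1 else 0) := by
    refine (integrable_discount hr).mul_bdd (c := 1) hm.aestronglyMeasurable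
      (Eventually.of_forall fun t => ?_)
    split_ifs <;> simp
  have h0 : 0 ≤ ∫ t : ℝ≥0, discount r t * (if p.1 t ≠ p.2 t then 1 else 0) :=
    integral_nonneg fun t => mul_nonneg (discount_nonneg hr t) (by split_ifs <;> simp)
  rw [Control.edist_eq hr, ENNReal.toReal_ofReal h0]
  nth_rw 1 [← integral_discount hr]
  rw [← integral_sub (integrable_discount hr) hint, payoff]
  refine integral_congr_ae (Eventually.of_forall fun t => ?_)
  by_cases h : p.1 t = p.2 t <;> simp [stagePayoff, h]

theorem payoff_aqua (hr : 0 < r) (p : Control r × Control r) :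
    payoff .aqua p = 1 - (edist p.1.flip p.2).toReal := by
  rw [← payoff_bard hr (p.1.flip, p.2), payoff, payoff]
  refine integral_congr_ae (Eventually.of_forall fun t => ?_)
  have h : ∀ x y : Bool, stagePayoff .aqua x y = stagePayoff .bard (!x) y := by
    intro x y
    cases x <;> cases y <;> simp [stagePayoff]
  simp only [h, Control.flip_apply]

theorem integral_one_sub_edist_toReal (hr : 0 < r) {Ω : Type u} [MeasurableSpace Ω]
    {P : Measure Ω} [IsProbabilityMeasure P] {F : Ω → Control r × Control r}
    (hF : AEMeasurable F P) :
    ∫ ω, (1 - (edist (F ω).1 (F ω).2).toReal) ∂P = 1 - (∫⁻ ω, edist (F ω).1 (F ω).2 ∂P).toReal := by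
  have hm : AEMeasurable (fun ω => edist (F ω).1 (F ω).2) P := by
    have h := (measurable_edist_control hr).comp_aemeasurable hF
    exact h
  have hle : ∀ ω, edist (F ω).1 (F ω).2 ≤ 1 := fun ω => edist_control_le_one hr _ _
  have hint : Integrable (fun ω => (edist (F ω).1 (F ω).2).toReal) P := by
    refine integrable_toReal_of_lintegral_ne_top hm (ne_top_of_le_ne_top ENNReal.one_ne_top
      ((lintegral_mono hle).trans ?_))
    simp
  rw [integral_sub (integrable_const 1) hint, integral_toReal hm
    (Eventually.of_forall fun ω => (hle ω).trans_lt ENNReal.one_lt_top)]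
  simp

theorem playLaw_toMixed_right (hr : 0 < r) (μA : MixedStrategy.{u} r) (σ : Strategy r) :
    playLaw μA (Strategy.toMixed.{v} σ) =
      μA.P.map fun ω => play (fun f => μA.act (ω, f)) σ.1 := by
  have h := aemeasurable_play hr μA (Strategy.toMixed.{v} σ)
  have hP : μA.P.prod (Strategy.toMixed.{v} σ).P = μA.P.map fun ω => (ω, PUnit.unit) :=
    Measure.prod_dirac _
  rw [playLaw]
  rw [hP] at h ⊢
  exact AEMeasurable.map_map_of_aemeasurable h
    (measurable_id.prodMk measurable_const).aemeasurable

theorem playLaw_toMixed_left (hr : 0 < r) (σ : Strategy r) (μB : MixedStrategy.{u} r) :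
    playLaw (Strategy.toMixed.{v} σ) μB =
      μB.P.map fun ω => play σ.1 (fun f => μB.act (ω, f)) := by
  have h := aemeasurable_play hr (Strategy.toMixed.{v} σ) μB
  have hP : (Strategy.toMixed.{v} σ).P.prod μB.P = μB.P.map fun ω => (PUnit.unit, ω) :=
    Measure.dirac_prod _
  rw [playLaw]
  rw [hP] at h ⊢
  exact AEMeasurable.map_map_of_aemeasurable h
    (measurable_const.prodMk measurable_id).aemeasurable

theorem aemeasurable_play_right (hr : 0 < r) (σ : Strategy r) (μ : MixedStrategy.{u} r) :
    AEMeasurable (fun ω : μ.Ω => play σ.1 (fun f => μ.act (ω, f))) μ.P := by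
  have h := aemeasurable_play hr (Strategy.toMixed.{0} σ) μ
  have hP : (Strategy.toMixed.{0} σ).P.prod μ.P = μ.P.map fun ω => (PUnit.unit, ω) :=
    Measure.dirac_prod _
  rw [hP] at h
  exact h.comp_measurable (measurable_const.prodMk measurable_id)

theorem expectedPayoff_bard (hr : 0 < r) (μA : MixedStrategy.{u} r) (σ : Strategy r) :
    expectedPayoff .bard μA (Strategy.toMixed.{v} σ) = 1 - (∫⁻ ω,
      edist (play (fun f => μA.act (ω, f)) σ.1).1 (play (fun f => μA.act (ω, f)) σ.1).2
        ∂μA.P).toReal := by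
  have hm : Measurable fun p : Control r × Control r => 1 - (edist p.1 p.2).toReal :=
    (measurable_edist_control hr).ennreal_toReal.const_sub 1
  have hF := aemeasurable_play_left hr μA σ
  rw [expectedPayoff, playLaw_toMixed_right hr]
  simp only [payoff_bard hr]
  rw [integral_map hF hm.aestronglyMeasurable]
  exact integral_one_sub_edist_toReal hr hF

theorem expectedPayoff_aqua (hr : 0 < r) (σ : Strategy r) (μB : MixedStrategy.{u} r) :
    expectedPayoff .aqua (Strategy.toMixed.{v} σ) μB = 1 - (∫⁻ ω,
      edist (play σ.1 (fun f => μB.act (ω, f))).1.flip (play σ.1 (fun f => μB.act (ω, f))).2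
        ∂μB.P).toReal := by
  have hflip : Measurable fun p : Control r × Control r => (p.1.flip, p.2) :=
    (Control.measurable_flip.comp measurable_fst).prodMk measurable_snd
  have hm : Measurable fun p : Control r × Control r => 1 - (edist p.1.flip p.2).toReal := by
    have h := ((measurable_edist_control hr).comp hflip).ennreal_toReal.const_sub 1
    exact h
  have hF := aemeasurable_play_right hr σ μB
  rw [expectedPayoff, playLaw_toMixed_left hr]
  simp only [payoff_aqua hr]
  rw [integral_map hF hm.aestronglyMeasurable]
  exact integral_one_sub_edist_toReal hr (hflip.comp_aemeasurable hF)

theorem exists_strategy_expectedPayoff_bard (hr : 0 < r) (μA : MixedStrategy.{u} r) {ε : ℝ}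
    (hε : 0 < ε) :
    ∃ σB : Strategy r, 1 - ε < expectedPayoff .bard μA (Strategy.toMixed.{v} σB) := by
  obtain ⟨σ, hσ⟩ := exists_strategy_lintegral_edist_le hr μA
    (ENNReal.ofReal_pos.2 (half_pos hε)).ne'
  refine ⟨σ, ?_⟩
  rw [expectedPayoff_bard hr]
  have := ENNReal.toReal_le_of_le_ofReal (half_pos hε).le hσ
  linarith

/-- Mismatching means matching after one's own actions are exchanged. Aqua plays the exchange of a
following strategy `σ`; seen from `σ`, the opponent is Bard answering exchanged controls, that is
`μB.compFlip`. -/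
theorem exists_strategy_expectedPayoff_aqua (hr : 0 < r) (μB : MixedStrategy.{u} r) {ε : ℝ}
    (hε : 0 < ε) :
    ∃ σA : Strategy r, 1 - ε < expectedPayoff .aqua (Strategy.toMixed.{v} σA) μB := by
  obtain ⟨σ, hσ⟩ := exists_strategy_lintegral_edist_le hr μB.compFlip
    (ENNReal.ofReal_pos.2 (half_pos hε)).ne'
  let τ : Strategy r := ⟨_, σ.2.flip_comp⟩
  refine ⟨τ, ?_⟩
  rw [expectedPayoff_aqua hr]
  have heq : ∫⁻ ω, edist (play τ.1 (fun f => μB.act (ω, f))).1.flip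
      (play τ.1 (fun f => μB.act (ω, f))).2 ∂μB.P = ∫⁻ ω,
      edist (play (fun f => μB.compFlip.act (ω, f)) σ.1).1
        (play (fun f => μB.compFlip.act (ω, f)) σ.1).2 ∂μB.compFlip.P := by
    refine lintegral_congr_ae ?_
    filter_upwards [μB.ae_isStrategy] with ω hω
    have hp := isPlay_play τ.2 hω
    have hω' : IsStrategy fun f => μB.compFlip.act (ω, f) := hω.comp_flip
    have hq := isPlay_play hω' σ.2
    set p := play τ.1 (fun f => μB.act (ω, f))
    set q := play (fun f => μB.compFlip.act (ω, f)) σ.1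
    -- The seats are swapped here: the followed player comes first in `q` but is Bard in the actual
    -- game. Uniqueness of the play then identifies the two up to null sets.
    have hq' : IsPlay τ.1 (fun f => μB.act (ω, f)) (q.2.flip, q.1) := by
      refine ⟨?_, hq.1⟩
      filter_upwards [hq.2] with s hs
      change (σ.1 q.1).flip s = q.2.flip s
      rw [Control.flip_apply, Control.flip_apply, hs]
    obtain ⟨h1, h2⟩ := IsPlay.ae_unique τ.2 hω hp hq'
    rw [edist_comm q.1, Control.edist_eq_measure, Control.edist_eq_measure]
    refine measure_congr (discountMeasure_absolutelyContinuous.ae_eq ?_)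
    filter_upwards [h1, h2] with s hs1 hs2
    refine propext (not_congr ?_)
    rw [Control.flip_apply, hs1, hs2, Control.flip_apply, Bool.not_not]
  have := ENNReal.toReal_le_of_le_ofReal (half_pos hε).le (heq.le.trans hσ)
  linarith

/-! ### Minmax values -/

theorem oneShotPureMinmax_eq_one (i : Player) : oneShotPureMinmax i = 1 := by
  cases i
  · have h : ∀ y : Action, ⨆ x : Action, stagePayoff .aqua x y = 1 := fun y =>
      le_antisymm (ciSup_le fun x => (stagePayoff_mem_Icc _ x y).2)
        (le_ciSup_of_le (finite_range _).bddAbove (!y) (by simp [stagePayoff]))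
    simp only [oneShotPureMinmax, h, ciInf_const]
  · have h : ∀ x : Action, ⨆ y : Action, stagePayoff .bard x y = 1 := fun x =>
      le_antisymm (ciSup_le fun y => (stagePayoff_mem_Icc _ x y).2)
        (le_ciSup_of_le (finite_range _).bddAbove x (by simp [stagePayoff]))
    simp only [oneShotPureMinmax, h, ciInf_const]

theorem ciSup_eq_one_of_forall_lt {ι : Type*} [Nonempty ι] {f : ι → ℝ} (h1 : ∀ i, f i ≤ 1)
    (h : ∀ ε : ℝ, 0 < ε → ∃ i, 1 - ε < f i) : ⨆ i, f i = 1 := by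
  refine ciSup_eq_of_forall_le_of_forall_lt_exists_gt h1 fun w hw => ?_
  obtain ⟨i, hi⟩ := h (1 - w) (sub_pos.2 hw)
  exact ⟨i, by linarith⟩

/-- Against each opponent strategy the supremum is already 1: pure answers approach it and no payoff
exceeds it. The infimum is thus over a constant. -/
theorem minmaxValue_eq_one (hr : 0 < r) (i : Player) : minmaxValue.{u, v} r i = 1 := by
  have := nonempty_mixedStrategy.{u} r
  have := nonempty_mixedStrategy.{v} r
  cases i
  · have h : ∀ μB : MixedStrategy.{u} r,
        ⨆ μA : MixedStrategy.{v} r, expectedPayoff .aqua μA μB = 1 := fun μB =>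
      ciSup_eq_one_of_forall_lt (fun μA => (expectedPayoff_mem_Icc hr _ μA μB).2) fun ε hε =>
        (exists_strategy_expectedPayoff_aqua hr μB hε).imp' Strategy.toMixed fun _ h => h
    simp only [minmaxValue, h, ciInf_const]
  · have h : ∀ μA : MixedStrategy.{u} r,
        ⨆ μB : MixedStrategy.{v} r, expectedPayoff .bard μA μB = 1 := fun μA =>
      ciSup_eq_one_of_forall_lt (fun μB => (expectedPayoff_mem_Icc hr _ μA μB).2) fun ε hε =>
        (exists_strategy_expectedPayoff_bard hr μA hε).imp' Strategy.toMixed fun _ h => h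
    simp only [minmaxValue, h, ciInf_const]

end MatchingPennies

end

open MatchingPennies in
theorem mainTheorem4 (r : ℝ) (hr : 0 < r) :
    (∀ (μA : MixedStrategy.{u} r) (ε : ℝ), 0 < ε →
      ∃ σB : Strategy r, 1 - ε < expectedPayoff .bard μA (Strategy.toMixed.{v} σB)) ∧
    (∀ (μB : MixedStrategy.{u} r) (ε : ℝ), 0 < ε →
      ∃ σA : Strategy r, 1 - ε < expectedPayoff .aqua (Strategy.toMixed.{v} σA) μB) ∧
    (∀ i : Player, minmaxValue.{u, v} r i = oneShotPureMinmax i ∧ oneShotPureMinmax i = 1) := by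
  refine ⟨fun μA _ hε => exists_strategy_expectedPayoff_bard hr μA hε,
    fun μB _ hε => exists_strategy_expectedPayoff_aqua hr μB hε, fun i => ⟨?_, ?_⟩⟩
  · rw [minmaxValue_eq_one hr, oneShotPureMinmax_eq_one]
  · exact oneShotPureMinmax_eq_one i
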